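/- **Setting.** Let $D\subset\mathbb R^3$ be a bounded Lipschitz domain whose boundary is made up of five measurable pieces $\Gamma_1,\dots,\Gamma_5$ that overlap pairwise at most in sets of surface measure zero. Let $\|\cdot\|_{0,\Sigma}$ be the $L^2(\Sigma;\mathbb C)$ norm, $|u|_{1,D}=\|\nabla u\|_{0,D}$, $\|u\|_{\mathcal H,D}=k\|u\|_{0,D}+|u|_{1,D}$, and $V_0=\{u\in H^1(D;\mathbb C): u|_{\Gamma_1}=0\}$. For $k>0$ and $\xi\in\mathbb C$ with $\operatorname{Re}\xi>0$ put $$a_{k,\xi}(u,\phi)=\int_D\nabla u\cdot\nabla\overline\phi\,dx-k^2\int_D u\overline\phi\,dx+\frac{ik}{\xi}\int_{\Gamma_2}u\overline\phi\,ds+ik\int_{\Gamma_4}u\overline\phi\,ds .$$ **Stability assumption.** There is a positive continuous function $C_1(k,\xi)$ of $k>0$ and $\operatorname{Re}\xi>0$ such that, for all such $k,\xi$ and all $\tilde f\in L^2(D;\mathbb C)$, $\tilde g\in L^2(\Gamma_2\cup\Gamma_4;\mathbb C)$, every $\tilde p\in V_0$ with $a_{k,\xi}(\tilde p,\phi)=\int_D\tilde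 f\,\overline\phi\,dx+\int_{\Gamma_2\cup\Gamma_4}\tilde g\,\overline\phi\,ds$ for all $\phi\in V_0$ satisfies $$\|\tilde p\|_{\mathcal H,D}\le C_1(k,\xi)\,\big(\|\tilde f\|_{0,D}+\|\tilde g\|_{0,\Gamma_2\cup\Gamma_4}\big).$$ **Stochastic problem.** Let $g$ be a function on $\Gamma_1$ and let $p_g\in H^1(D;\mathbb C)$ be a weak solution of $-\Delta p_g=0$ in $D$, $p_g=g$ on $\Gamma_1$, $\partial p_g/\partial\mathbf n=0$ on $\partial D\setminus\Gamma_1$. Let $\Lambda\subset\mathbb R^+\times\mathbb R^2$ be bounded and measurable with a probability density $\rho:\Lambda\to[0,\infty]$, and write $\vartheta=(k,\mu_{\rm r},\mu_{\rm i})\in\Lambda$, $\mu=\mu_{\rm r}+i\mu_{\rm i}$. A weak solution for the impedance $\xi$ is a strongly measurable map $p$ on $\Lambda$ with values in $H^1(D;\mathbb C)$ such that $p(\cdot,\vartheta)|_{\Gamma_1}=\mu g$ for almost every $\vartheta$ with respect to $\rho\,d\vartheta$, $\int_\Lambda\|p(\cdot,\vartheta)\|_{1,D}^2\rho(\vartheta)\,d\vartheta<\infty$,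 and $$\int_\Lambda a_{k,\xi}(p,\phi)\,\rho(\vartheta)\,d\vartheta=0\qquad\text{for all }\phi\in L^2_\rho(\Lambda;V_0).$$ **Lemma.** Under the stability assumption there is a positive continuous function $C(k,\xi)$ of $k>0$ and $\operatorname{Re}\xi>0$, depending only on $D$, $\Gamma_1,\dots,\Gamma_5$ and $C_1$ (not on $g,\Lambda,\rho,\xi_1,\xi_2$ or the solutions), such that for all $\xi_1,\xi_2$ with positive real parts, and all weak solutions $p_1,p_2$ for the impedances $\xi_1,\xi_2$ (with the same $g,\Lambda,\rho$), for almost every $\vartheta\in\Lambda$ with respect to $\rho\,d\vartheta$, $$\|p_1-p_2\|_{\mathcal H,D}\le C(k,\xi_1)\big(\|p_2\|_{0,\Gamma_2}+|\mu|\,k\,\|p_g\|_{0,\Gamma_2}\big)\Big|\frac1{\xi_1}-\frac1{\xi_2}\Big| .$$ Moreover, with the function $C_1$ of the stability assumption itself, $$\|p_1-p_2\|_{\mathcal H,D}\le C_1(k,\xi_1)\big(k\,\|p_2\|_{0,\Gamma_2}+|\mu|\,k\,\|p_g\|_{0,\Gamma_2}\big)\Big|\frac1{\xi_1}-\frac1{\xi_2}\Big|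 .$$ -/

import Mathlib

open MeasureTheory Filter Topology
open scoped ENNReal ContDiff ComplexConjugate

noncomputable section

namespace Helmholtz

/-- Physical space `ℝ³` with its Euclidean norm. -/
abbrev E3 : Type := EuclideanSpace ℝ (Fin 3)

/-- `ℂ³` with its Hermitian norm: the values of the gradients. -/
abbrev C3 : Type := EuclideanSpace ℂ (Fin 3)

/-- Bounded Lipschitz domain: bounded, open, connected (nonempty), and near every boundary point,
in suitable Cartesian coordinates, the region above the graph of a Lipschitz function. -/
structure IsLipschitzDomain (D : Set E3) : Prop where
  isOpen : IsOpen D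
  isConnected : IsConnected D
  isBounded : Bornology.IsBounded D
  graph : ∀ x ∈ frontier D, ∃ U : Set E3, IsOpen U ∧ x ∈ U ∧
    ∃ (e : E3 ≃ᵢ E3) (γ : EuclideanSpace ℝ (Fin 2) → ℝ), (∃ K, LipschitzWith K γ) ∧
      ∀ y ∈ U, (y ∈ D ↔ γ !₂[e y 0, e y 1] < e y 2)

/-- Lebesgue measure on `D`. -/
abbrev vol (D : Set E3) : Measure E3 := (volume : Measure E3).restrict D

/-- Surface measure on `∂D`: the two-dimensional Hausdorff measure in its Euclidean normalization,
restricted to the boundary. -/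
abbrev surf (D : Set E3) : Measure E3 :=
  (Measure.euclideanHausdorffMeasure 2 : Measure E3).restrict (frontier D)

/-- `Γ₁, …, Γ₅` are measurable pieces that make up `∂D`; they overlap at most in
sets of surface measure zero (for instance along common edges). -/
structure IsBoundaryPartition (D Γ₁ Γ₂ Γ₃ Γ₄ Γ₅ : Set E3) : Prop where
  measurable : ∀ i, MeasurableSet (![Γ₁, Γ₂, Γ₃, Γ₄, Γ₅] i)
  subset : ∀ i, ![Γ₁, Γ₂, Γ₃, Γ₄, Γ₅] i ⊆ frontier D
  aedisjoint : Pairwise fun i j =>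
    AEDisjoint (surf D) (![Γ₁, Γ₂, Γ₃, Γ₄, Γ₅] i) (![Γ₁, Γ₂, Γ₃, Γ₄, Γ₅] j)
  cover : surf D (frontier D \ (Γ₁ ∪ Γ₂ ∪ Γ₃ ∪ Γ₄ ∪ Γ₅)) = 0

/-- The `L²` norm `‖f‖_{0}` with respect to a measure (used with square-integrable `f`). -/
def l2norm {F : Type*} [NormedAddCommGroup F] (m : Measure E3) (f : E3 → F) : ℝ :=
  (eLpNorm f 2 m).toReal

/-- `∂_i ψ`. -/
def partialDeriv {F : Type*} [NormedAddCommGroup F] [NormedSpace ℝ F] (i : Fin 3)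
    (ψ : E3 → F) (x : E3) : F :=
  fderiv ℝ ψ x (EuclideanSpace.single i 1)

/-- The classical gradient of a complex-valued function. -/
def grad (ψ : E3 → ℂ) (x : E3) : C3 := WithLp.toLp 2 fun i => partialDeriv i ψ x

/-- Candidates for elements of `H¹(D; ℂ)`, written as triples `(u, ∇u, u|_{∂D})` in
`L²(D; ℂ) × L²(D; ℂ³) × L²(∂D; ℂ)`. -/
abbrev H1Data (D : Set E3) : Type :=
  Lp ℂ 2 (vol D) × Lp C3 2 (vol D) × Lp ℂ 2 (surf D)

/-- The function component `u`. -/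
abbrev H1Data.val {D : Set E3} (u : H1Data D) : Lp ℂ 2 (vol D) := u.1

/-- The gradient component `∇u`. -/
abbrev H1Data.gradient {D : Set E3} (u : H1Data D) : Lp C3 2 (vol D) := u.2.1

/-- The boundary component `u|_{∂D}`. -/
abbrev H1Data.trace {D : Set E3} (u : H1Data D) : Lp ℂ 2 (surf D) := u.2.2

/-- `G` is the weak gradient of `u` in `D`. -/
def IsWeakGradient (D : Set E3) (u : Lp ℂ 2 (vol D)) (G : Lp C3 2 (vol D)) : Prop :=
  ∀ φ : E3 → ℝ, ContDiff ℝ ∞ φ → HasCompactSupport φ → tsupport φ ⊆ D → ∀ i : Fin 3,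
    ∫ x, u x * ((partialDeriv i φ x : ℝ) : ℂ) ∂(vol D) = -∫ x, G x i * (φ x : ℂ) ∂(vol D)

/-- `t` is the trace on `∂D` of the function `u` with weak gradient `G`: smooth functions on
`ℝ³` exist which converge to `u` in `H¹(D)` and whose boundary values converge to `t` in
`L²(∂D)`. On a bounded Lipschitz domain this is the graph of the trace operator
`H¹(D) → L²(∂D)`, the continuous extension of `ψ ↦ ψ|_{∂D}` from the dense set of smooth `ψ`. -/
def IsTrace (D : Set E3) (u : Lp ℂ 2 (vol D)) (G : Lp C3 2 (vol D)) (t : Lp ℂ 2 (surf D)) : Prop :=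
  ∃ ψ : ℕ → E3 → ℂ, (∀ n, ContDiff ℝ ∞ (ψ n)) ∧
    Tendsto (fun n => eLpNorm (fun x => ψ n x - u x) 2 (vol D)) atTop (𝓝 0) ∧
    Tendsto (fun n => eLpNorm (fun x => grad (ψ n) x - G x) 2 (vol D)) atTop (𝓝 0) ∧
    Tendsto (fun n => eLpNorm (fun x => ψ n x - t x) 2 (surf D)) atTop (𝓝 0)

/-- `u` is an element of `H¹(D; ℂ)`, recorded with its weak gradient and its trace. -/
def IsH1 (D : Set E3) (u : H1Data D) : Prop :=
  IsWeakGradient D u.val u.gradient ∧ IsTrace D u.val u.gradient u.trace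

/-- The functions in `H¹(D; ℂ)` whose trace on `Γ₁` is `h`. -/
def V (D Γ₁ : Set E3) (h : E3 → ℂ) : Set (H1Data D) :=
  {u | IsH1 D u ∧ ∀ᵐ x ∂((surf D).restrict Γ₁), u.trace x = h x}

/-- `V₀ = H¹_{Γ₁}(D; ℂ)`. -/
def V₀ (D Γ₁ : Set E3) : Set (H1Data D) := V D Γ₁ 0

/-- The wavenumber-dependent norm `‖u‖_{𝓗,D} = k ‖u‖_{0,D} + |u|_{1,D}`. -/
def hNorm {D : Set E3} (k : ℝ) (u : H1Data D) : ℝ :=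
  k * l2norm (vol D) u.val + l2norm (vol D) u.gradient

/-- The square `‖u‖²_{1,D}` of the `H¹(D)` norm, with values in `[0, ∞]`. -/
def h1NormSq {D : Set E3} (u : H1Data D) : ℝ≥0∞ :=
  eLpNorm u.val 2 (vol D) ^ 2 + eLpNorm u.gradient 2 (vol D) ^ 2

/-- The Dirichlet form `∫_D ∇u · conj (∇φ)` (the inner product is conjugate-linear in its first
argument). -/
def dirichletForm {D : Set E3} (u φ : H1Data D) : ℂ :=
  ∫ x, inner ℂ (φ.gradient x) (u.gradient x) ∂(vol D)

/-- The sesquilinear form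
`a(u,φ) = ∫_D ∇u·∇φ̄ - k² ∫_D u φ̄ + (ik/ξ) ∫_{Γ₂} u φ̄ + ik ∫_{Γ₄} u φ̄`. -/
def helmholtzForm {D : Set E3} (Γ₂ Γ₄ : Set E3) (k : ℝ) (ξ : ℂ) (u φ : H1Data D) : ℂ :=
  dirichletForm u φ
    - (k : ℂ) ^ 2 * ∫ x, u.val x * conj (φ.val x) ∂(vol D)
    + Complex.I * k / ξ * ∫ x in Γ₂, u.trace x * conj (φ.trace x) ∂(surf D)
    + Complex.I * k * ∫ x in Γ₄, u.trace x * conj (φ.trace x) ∂(surf D)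

/-- `u` is the weak solution of `-Δu - k²u = f` in `D`, `u = 0` on `Γ₁`,
`∂u/∂n + i(k/ξ)u = g` on `Γ₂`, `∂u/∂n + iku = g` on `Γ₄`, `∂u/∂n = 0` on the rest of `∂D`. -/
def IsMixedWeakSolution {D : Set E3} (Γ₁ Γ₂ Γ₄ : Set E3) (k : ℝ) (ξ : ℂ) (f g : E3 → ℂ)
    (u : H1Data D) : Prop :=
  u ∈ V₀ D Γ₁ ∧ ∀ φ ∈ V₀ D Γ₁, helmholtzForm Γ₂ Γ₄ k ξ u φ =
    ∫ x, f x * conj (φ.val x) ∂(vol D) + ∫ x in Γ₂ ∪ Γ₄, g x * conj (φ.trace x) ∂(surf D)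

/-- `C(k, ξ)` is a positive continuous function of `k > 0` and of `ξ` with positive real part. -/
structure IsCoefficient (C : ℝ → ℂ → ℝ) : Prop where
  continuousOn : ContinuousOn (fun q : ℝ × ℂ => C q.1 q.2) {q | 0 < q.1 ∧ 0 < q.2.re}
  pos : ∀ (k : ℝ) (ξ : ℂ), 0 < k → 0 < ξ.re → 0 < C k ξ

/-- The stability assumption with coefficient `C₁`: for every `k > 0`, every `ξ` with positive
real part and all square-integrable data, `‖u‖_{𝓗,D} ≤ C₁(k,ξ) (‖f‖_{0,D} + ‖g‖_{0,Γ₂∪Γ₄})`. -/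
def StabilityEstimate (D Γ₁ Γ₂ Γ₄ : Set E3) (C₁ : ℝ → ℂ → ℝ) : Prop :=
  ∀ (k : ℝ) (ξ : ℂ), 0 < k → 0 < ξ.re →
    ∀ f g : E3 → ℂ, MemLp f 2 (vol D) → MemLp g 2 ((surf D).restrict (Γ₂ ∪ Γ₄)) →
      ∀ u : H1Data D, IsMixedWeakSolution Γ₁ Γ₂ Γ₄ k ξ f g u →
        hNorm k u ≤ C₁ k ξ * (l2norm (vol D) f + l2norm ((surf D).restrict (Γ₂ ∪ Γ₄)) g)

/-- `p_g ∈ H¹(D; ℂ)` is the weak solution of `-Δ p_g = 0` in `D`, `p_g = g` on `Γ₁`,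
`∂p_g/∂n = 0` on `∂D \ Γ₁`. -/
def IsHarmonicLift {D : Set E3} (Γ₁ : Set E3) (g : E3 → ℂ) (pg : H1Data D) : Prop :=
  pg ∈ V D Γ₁ g ∧ ∀ φ ∈ V₀ D Γ₁, dirichletForm pg φ = 0

/-- The values `ϑ = (k, μ_r, μ_i)` of the random vector. -/
abbrev Param : Type := ℝ × ℝ × ℝ

/-- The wavenumber `k`. -/
def Param.k (θ : Param) : ℝ := θ.1

/-- The amplitude `μ = μ_r + i μ_i`. -/
def Param.μ (θ : Param) : ℂ := ⟨θ.2.1, θ.2.2⟩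

/-- `Λ` is a bounded measurable subset of `ℝ⁺ × ℝ²` and `ρ : Λ → [0, ∞]` is a probability
density on it. -/
structure IsParamDensity (Λ : Set Param) (ρ : Param → ℝ≥0∞) : Prop where
  measurableSet : MeasurableSet Λ
  isBounded : Bornology.IsBounded Λ
  k_pos : ∀ θ ∈ Λ, 0 < θ.k
  measurable : Measurable ρ
  lintegral_eq_one : ∫⁻ θ in Λ, ρ θ = 1

/-- The law `ρ(ϑ) dϑ` on `Λ`. -/
def law (Λ : Set Param) (ρ : Param → ℝ≥0∞) : Measure Param :=
  ((volume : Measure Param).restrict Λ).withDensity ρ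

/-- `p` is strongly measurable, `p(ϑ) ∈ S(ϑ)` almost surely, and
`∫_Λ ‖p(ϑ)‖²_{1,D} ρ(ϑ) dϑ < ∞`. -/
structure IsL2Section {D : Set E3} (Λ : Set Param) (ρ : Param → ℝ≥0∞)
    (S : Param → Set (H1Data D)) (p : Param → H1Data D) : Prop where
  aestronglyMeasurable : AEStronglyMeasurable p (law Λ ρ)
  mem : ∀ᵐ θ ∂(law Λ ρ), p θ ∈ S θ
  lintegral_lt_top : ∫⁻ θ, h1NormSq (p θ) ∂(law Λ ρ) < ⊤

/-- The space `Y`: square-integrable `p` with `p(ϑ) = μ g` on `Γ₁`. -/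
def Y (D Γ₁ : Set E3) (g : E3 → ℂ) (Λ : Set Param) (ρ : Param → ℝ≥0∞) :
    Set (Param → H1Data D) :=
  {p | IsL2Section Λ ρ (fun θ => V D Γ₁ (fun x => θ.μ * g x)) p}

/-- The space `Y₀ = L²_ρ(Λ; V₀)`. -/
def Y₀ (D Γ₁ : Set E3) (Λ : Set Param) (ρ : Param → ℝ≥0∞) : Set (Param → H1Data D) :=
  {φ | IsL2Section Λ ρ (fun _ => V₀ D Γ₁) φ}

/-- `p` is a weak solution in `Y` of the stochastic Helmholtz problem with impedance `ξ`:
`∫_Λ a_ϑ(p, φ) ρ(ϑ) dϑ = 0` for all `φ ∈ Y₀`. -/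
def IsStochasticSolution (D Γ₁ Γ₂ Γ₄ : Set E3) (g : E3 → ℂ) (Λ : Set Param)
    (ρ : Param → ℝ≥0∞) (ξ : ℂ) (p : Param → H1Data D) : Prop :=
  p ∈ Y D Γ₁ g Λ ρ ∧ ∀ φ ∈ Y₀ D Γ₁ Λ ρ,
    ∫ θ, helmholtzForm Γ₂ Γ₄ θ.k ξ (p θ) (φ θ) ∂(law Λ ρ) = 0

end Helmholtz

end

namespace Helmholtz

variable {D : Set E3}

/-! The stochastic equation first decouples into a deterministic one for almost every ϑ
(`ae_helmholtzForm_eq_zero`). The form is a(u, φ) = ⟪φ, A u⟫ in a Hilbert space, and V₀ is a closed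
subspace, so the orthogonal projection R(ϑ) of A p(ϑ) onto V₀, scaled by 1/(1 + ‖R‖²), is an
admissible bounded test section. Testing with it makes the integral of ‖R‖²/(1 + ‖R‖²) vanish, hence
R = 0 almost everywhere. This single test replaces a countable dense family, and A p(ϑ) need not be
integrable.

For fixed ϑ the forms for ξ₁ and ξ₂ differ only in the Γ₂ term. Hence p₁ - p₂ lies in V₀ and solves
the mixed problem for ξ₁ with zero volume source and boundary datum -ik(1/ξ₁ - 1/ξ₂) p₂ on Γ₂, zero
elsewhere (`isMixedWeakSolution_sub`). Stability bounds it by C₁ k ‖p₂‖ |1/ξ₁ - 1/ξ₂|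
(`hNorm_sub_le`). Both claims follow with C = k C₁, as the p_g term is nonnegative. -/

/-! ### H¹(D) and V₀ as closed subspaces. -/

theorem partialDeriv_add {F : Type*} [NormedAddCommGroup F] [NormedSpace ℝ F] {ψ χ : E3 → F}
    (hψ : ContDiff ℝ ∞ ψ) (hχ : ContDiff ℝ ∞ χ) (i : Fin 3) (x : E3) :
    partialDeriv i (fun y => ψ y + χ y) x = partialDeriv i ψ x + partialDeriv i χ x := by
  unfold partialDeriv
  rw [fderiv_fun_add (hψ.differentiable (by simp) x) (hχ.differentiable (by simp) x)]
  rfl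

theorem grad_add {ψ χ : E3 → ℂ} (hψ : ContDiff ℝ ∞ ψ) (hχ : ContDiff ℝ ∞ χ) (x : E3) :
    grad (fun y => ψ y + χ y) x = grad ψ x + grad χ x := by
  ext i
  simp [grad, partialDeriv_add hψ hχ]

theorem grad_const_mul {ψ : E3 → ℂ} (hψ : ContDiff ℝ ∞ ψ) (c : ℂ) (x : E3) :
    grad (fun y => c * ψ y) x = c • grad ψ x := by
  ext i
  simp only [grad, partialDeriv, PiLp.smul_apply, smul_eq_mul]
  rw [fderiv_const_mul (hψ.differentiable (by simp) x)]
  rfl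

theorem continuous_partialDeriv {F : Type*} [NormedAddCommGroup F] [NormedSpace ℝ F] {ψ : E3 → F}
    (hψ : ContDiff ℝ ∞ ψ) (i : Fin 3) : Continuous (partialDeriv i ψ) :=
  (hψ.continuous_fderiv (by simp)).clm_apply continuous_const

theorem continuous_grad {ψ : E3 → ℂ} (hψ : ContDiff ℝ ∞ ψ) : Continuous (grad ψ) :=
  (PiLp.continuous_toLp 2 _).comp (continuous_pi fun i => continuous_partialDeriv hψ i)

/-- The triples `(ψ, ∇ψ, ψ|_{∂D})` of smooth functions `ψ` on `ℝ³`. -/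
def smoothTriples (D : Set E3) : Submodule ℂ (H1Data D) where
  carrier := {u | ∃ ψ : E3 → ℂ, ContDiff ℝ ∞ ψ ∧ u.val =ᵐ[vol D] ψ ∧
    u.gradient =ᵐ[vol D] grad ψ ∧ u.trace =ᵐ[surf D] ψ}
  zero_mem' := by
    refine ⟨fun _ => 0, contDiff_const, Lp.coeFn_zero _ _ _, (Lp.coeFn_zero _ _ _).trans ?_,
      Lp.coeFn_zero _ _ _⟩
    refine .of_forall fun x => ?_
    ext i
    simp [grad, partialDeriv]
  add_mem' := by
    rintro u v ⟨ψ, hψ, h1, h2, h3⟩ ⟨χ, hχ, k1, k2, k3⟩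
    refine ⟨fun x => ψ x + χ x, hψ.add hχ, (Lp.coeFn_add _ _).trans (h1.add k1),
      (Lp.coeFn_add _ _).trans ((h2.add k2).trans ?_), (Lp.coeFn_add _ _).trans (h3.add k3)⟩
    exact .of_forall fun x => (grad_add hψ hχ x).symm
  smul_mem' := by
    rintro c u ⟨ψ, hψ, h1, h2, h3⟩
    refine ⟨fun x => c * ψ x, contDiff_const.mul hψ, (Lp.coeFn_smul _ _).trans (h1.const_smul c),
      (Lp.coeFn_smul _ _).trans ((h2.const_smul c).trans ?_),
      (Lp.coeFn_smul _ _).trans (h3.const_smul c)⟩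
    exact .of_forall fun x => (grad_const_mul hψ c x).symm

theorem memLp_of_eLpNorm_sub_lt_top {F : Type*} [NormedAddCommGroup F] {m : Measure E3}
    {f : E3 → F} (hf : AEStronglyMeasurable f m) (u : Lp F 2 m)
    (h : eLpNorm (fun x => f x - u x) 2 m < ⊤) : MemLp f 2 m := by
  have : MemLp (fun x => f x - u x) 2 m := ⟨hf.sub (Lp.aestronglyMeasurable u), h⟩
  convert this.add (Lp.memLp u) using 1
  ext x
  simp

theorem tendsto_toLp_of_eLpNorm_sub {F : Type*} [NormedAddCommGroup F] {m : Measure E3}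
    {f : ℕ → E3 → F} (hf : ∀ n, MemLp (f n) 2 m) {u : Lp F 2 m}
    (h : Tendsto (fun n => eLpNorm (fun x => f n x - u x) 2 m) atTop (𝓝 0)) :
    Tendsto (fun n => (hf n).toLp (f n)) atTop (𝓝 u) := by
  rw [tendsto_iff_edist_tendsto_0]
  refine h.congr fun n => ?_
  rw [Lp.edist_def]
  exact eLpNorm_congr_ae ((hf n).coeFn_toLp.symm.sub (ae_eq_refl _))

theorem tendsto_eLpNorm_sub_of_ae_eq {F : Type*} [NormedAddCommGroup F] {m : Measure E3}
    {f : ℕ → E3 → F} {v : ℕ → Lp F 2 m} (hf : ∀ n, v n =ᵐ[m] f n) {u : Lp F 2 m}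
    (h : Tendsto v atTop (𝓝 u)) :
    Tendsto (fun n => eLpNorm (fun x => f n x - u x) 2 m) atTop (𝓝 0) := by
  rw [tendsto_iff_edist_tendsto_0] at h
  refine h.congr fun n => ?_
  rw [Lp.edist_def]
  exact eLpNorm_congr_ae ((hf n).sub (ae_eq_refl _))

/-- Recasting the approximating sequences as the closure of a submodule yields linearity and
closedness at once. -/
theorem isTrace_iff_mem_closure (u : H1Data D) :
    IsTrace D u.val u.gradient u.trace ↔ u ∈ (smoothTriples D).topologicalClosure := by
  rw [← SetLike.mem_coe, Submodule.topologicalClosure_coe]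
  constructor
  · rintro ⟨ψ, hψ, h1, h2, h3⟩
    have hfin : ∀ᶠ n in atTop, MemLp (ψ n) 2 (vol D) ∧ MemLp (grad (ψ n)) 2 (vol D) ∧
        MemLp (ψ n) 2 (surf D) := by
      filter_upwards [h1.eventually_lt_const zero_lt_one, h2.eventually_lt_const zero_lt_one,
        h3.eventually_lt_const zero_lt_one] with n k1 k2 k3
      exact ⟨memLp_of_eLpNorm_sub_lt_top (hψ n).continuous.aestronglyMeasurable _
          (k1.trans ENNReal.one_lt_top),
        memLp_of_eLpNorm_sub_lt_top (continuous_grad (hψ n)).aestronglyMeasurable _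
          (k2.trans ENNReal.one_lt_top),
        memLp_of_eLpNorm_sub_lt_top (hψ n).continuous.aestronglyMeasurable _
          (k3.trans ENNReal.one_lt_top)⟩
    obtain ⟨N, hN⟩ := eventually_atTop.1 hfin
    -- The approximants are known to be square-integrable only from some index on, so the sequence
    -- is shifted to its tail.
    have hN' := fun n => hN (n + N) (Nat.le_add_left _ _)
    refine mem_closure_of_tendsto (f := fun n : ℕ =>
      (((hN' n).1.toLp _, (hN' n).2.1.toLp _, (hN' n).2.2.toLp _) : H1Data D)) (b := atTop) ?_
      (.of_forall fun n => ⟨ψ (n + N), hψ _, (hN' n).1.coeFn_toLp,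
        (hN' n).2.1.coeFn_toLp, (hN' n).2.2.coeFn_toLp⟩)
    exact (tendsto_toLp_of_eLpNorm_sub (fun n => (hN' n).1) (h1.comp (tendsto_add_atTop_nat N))).prodMk_nhds
      ((tendsto_toLp_of_eLpNorm_sub (fun n => (hN' n).2.1) (h2.comp (tendsto_add_atTop_nat N))).prodMk_nhds
      (tendsto_toLp_of_eLpNorm_sub (fun n => (hN' n).2.2) (h3.comp (tendsto_add_atTop_nat N))))
  · intro hu
    obtain ⟨v, hv, hlim⟩ := mem_closure_iff_seq_limit.1 hu
    choose ψ hψ h1 h2 h3 using hv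
    exact ⟨ψ, hψ,
      tendsto_eLpNorm_sub_of_ae_eq h1 ((continuous_fst.tendsto u).comp hlim),
      tendsto_eLpNorm_sub_of_ae_eq h2
        (((continuous_fst.comp continuous_snd).tendsto u).comp hlim),
      tendsto_eLpNorm_sub_of_ae_eq h3
        (((continuous_snd.comp continuous_snd).tendsto u).comp hlim)⟩

theorem hasCompactSupport_partialDeriv {φ : E3 → ℝ} (hφ : HasCompactSupport φ) (i : Fin 3) :
    HasCompactSupport (partialDeriv i φ) :=
  hφ.fderiv_apply ℝ _

/-- For one test function and one index, the weak gradient condition is the kernel of an L² pairing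
with ∂ᵢφ and φ eᵢ; intersecting these kernels gives a closed subspace. -/
theorem exists_clm_isWeakGradient {φ : E3 → ℝ} (hφ : ContDiff ℝ ∞ φ)
    (hc : HasCompactSupport φ) (i : Fin 3) :
    ∃ L : H1Data D →L[ℂ] ℂ, ∀ u : H1Data D, L u = 0 ↔
      ∫ x, u.val x * ((partialDeriv i φ x : ℝ) : ℂ) ∂(vol D) =
        -∫ x, u.gradient x i * (φ x : ℂ) ∂(vol D) := by
  have m1 : MemLp (fun x => ((partialDeriv i φ x : ℝ) : ℂ)) 2 (vol D) :=
    ((continuous_partialDeriv hφ i).memLp_of_hasCompactSupport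
      (hasCompactSupport_partialDeriv hc i)).ofReal
  have m2 : MemLp (fun x => EuclideanSpace.single i ((φ x : ℝ) : ℂ)) 2 (vol D) := by
    refine Continuous.memLp_of_hasCompactSupport ?_ ?_
    · refine (PiLp.continuous_toLp 2 _).comp ?_
      exact (continuous_single i).comp (Complex.continuous_ofReal.comp hφ.continuous)
    · refine hc.comp_left (g := fun r : ℝ => EuclideanSpace.single i (r : ℂ)) ?_
      ext j
      simp
  refine ⟨(innerSL ℂ m1.toLp).comp (.fst ℂ _ _) +
    (innerSL ℂ m2.toLp).comp ((ContinuousLinearMap.fst ℂ _ _).comp (.snd ℂ _ _)), fun u => ?_⟩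
  rw [← add_eq_zero_iff_eq_neg]
  have e1 : inner ℂ m1.toLp u.val = ∫ x, u.val x * ((partialDeriv i φ x : ℝ) : ℂ) ∂(vol D) := by
    rw [L2.inner_def]
    refine integral_congr_ae ?_
    filter_upwards [m1.coeFn_toLp] with x hx
    simp [hx]
  have e2 : inner ℂ m2.toLp u.gradient = ∫ x, u.gradient x i * (φ x : ℂ) ∂(vol D) := by
    rw [L2.inner_def]
    refine integral_congr_ae ?_
    filter_upwards [m2.coeFn_toLp] with x hx
    simp [hx, EuclideanSpace.inner_single_left, mul_comm]
  rw [← e1, ← e2]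
  rfl

/-- `H¹(D; ℂ)` is a closed subspace of the space of triples `(u, ∇u, u|_{∂D})`. -/
theorem exists_closed_submodule_isH1 (D : Set E3) :
    ∃ K : Submodule ℂ (H1Data D), IsClosed (K : Set (H1Data D)) ∧ ∀ u, u ∈ K ↔ IsH1 D u := by
  choose L hL using fun (φ : {φ : E3 → ℝ // ContDiff ℝ ∞ φ ∧ HasCompactSupport φ}) (i : Fin 3) =>
    exists_clm_isWeakGradient (D := D) φ.2.1 φ.2.2 i
  refine ⟨(⨅ (φ : {φ : E3 → ℝ // ContDiff ℝ ∞ φ ∧ HasCompactSupport φ}) (_ : tsupport φ.1 ⊆ D)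
    (i : Fin 3), (L φ i).ker) ⊓ (smoothTriples D).topologicalClosure, ?_, fun u => ?_⟩
  · simp only [Submodule.coe_inf, Submodule.coe_iInf]
    exact (isClosed_iInter fun φ => isClosed_iInter fun _ => isClosed_iInter fun i =>
      (L φ i).isClosed_ker).inter (Submodule.isClosed_topologicalClosure _)
  · rw [Submodule.mem_inf, ← isTrace_iff_mem_closure, IsH1]
    refine and_congr_left' ?_
    simp only [Submodule.mem_iInf, LinearMap.mem_ker, ContinuousLinearMap.coe_coe, hL]
    exact ⟨fun h φ h1 h2 h3 i => h ⟨φ, h1, h2⟩ h3 i, fun h φ h3 i => h φ.1 φ.2.1 φ.2.2 h3 i⟩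

theorem exists_closed_submodule_V₀ (D Γ₁ : Set E3) :
    ∃ K : Submodule ℂ (H1Data D), IsClosed (K : Set (H1Data D)) ∧ ∀ u, u ∈ K ↔ u ∈ V₀ D Γ₁ := by
  obtain ⟨K, hK, hmem⟩ := exists_closed_submodule_isH1 D
  let R : H1Data D →L[ℂ] Lp ℂ 2 ((surf D).restrict Γ₁) :=
    (LpToLpRestrictCLM E3 ℂ ℂ (surf D) 2 Γ₁).comp
      ((ContinuousLinearMap.snd ℂ _ _).comp (.snd ℂ _ _))
  refine ⟨K ⊓ R.ker, hK.inter R.isClosed_ker, fun u => ?_⟩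
  rw [Submodule.mem_inf, hmem]
  refine and_congr_right' ?_
  have h := LpToLpRestrictCLM_coeFn ℂ Γ₁ u.trace
  rw [LinearMap.mem_ker, Lp.eq_zero_iff_ae_eq_zero]
  exact ⟨fun h' => h.symm.trans h', fun h' => h.trans h'⟩

theorem sub_mem_V₀ {Γ₁ : Set E3} {h : E3 → ℂ} {u v : H1Data D} (hu : u ∈ V D Γ₁ h)
    (hv : v ∈ V D Γ₁ h) : u - v ∈ V₀ D Γ₁ := by
  obtain ⟨K, -, hmem⟩ := exists_closed_submodule_isH1 D
  refine ⟨(hmem _).1 (K.sub_mem ((hmem _).2 hu.1) ((hmem _).2 hv.1)), ?_⟩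
  have := ae_restrict_of_ae (s := Γ₁) (Lp.coeFn_sub u.trace v.trace)
  filter_upwards [this, hu.2, hv.2] with x hx h1 h2
  change (u.trace - v.trace : Lp ℂ 2 (surf D)) x = _
  rw [hx, Pi.sub_apply, h1, h2, sub_self, Pi.zero_apply]

/-! ### The Helmholtz form as an inner product. -/

/-- The Hilbert space of triples `(u, ∇u, u|_{∂D})`. -/
abbrev H1Hilbert (D : Set E3) : Type :=
  WithLp 2 (Lp ℂ 2 (vol D) × WithLp 2 (Lp C3 2 (vol D) × Lp ℂ 2 (surf D)))

/-- `H1Data D` as a Hilbert space. -/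
noncomputable def toHilbert (D : Set E3) : H1Data D ≃L[ℂ] H1Hilbert D :=
  ((ContinuousLinearEquiv.refl ℂ _).prodCongr
    (WithLp.prodContinuousLinearEquiv 2 ℂ _ _).symm).trans
    (WithLp.prodContinuousLinearEquiv 2 ℂ _ _).symm

/-- The function component. -/
noncomputable def valL (D : Set E3) : H1Hilbert D →L[ℂ] Lp ℂ 2 (vol D) :=
  (ContinuousLinearMap.fst ℂ _ _).comp (toHilbert D).symm.toContinuousLinearMap

/-- The gradient component. -/
noncomputable def gradientL (D : Set E3) : H1Hilbert D →L[ℂ] Lp C3 2 (vol D) :=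
  ((ContinuousLinearMap.fst ℂ _ _).comp (.snd ℂ _ _)).comp
    (toHilbert D).symm.toContinuousLinearMap

/-- The restriction of the boundary component to `Γ`. -/
noncomputable def traceL (D Γ : Set E3) : H1Hilbert D →L[ℂ] Lp ℂ 2 ((surf D).restrict Γ) :=
  (LpToLpRestrictCLM E3 ℂ ℂ (surf D) 2 Γ).comp
    (((ContinuousLinearMap.snd ℂ _ _).comp (.snd ℂ _ _)).comp
      (toHilbert D).symm.toContinuousLinearMap)

/-- `T* T`, the operator of the form `⟪T φ, T u⟫`. -/
noncomputable def gram {H F : Type*} [NormedAddCommGroup H] [InnerProductSpace ℂ H]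
    [CompleteSpace H] [NormedAddCommGroup F] [InnerProductSpace ℂ F] [CompleteSpace F]
    (T : H →L[ℂ] F) : H →L[ℂ] H :=
  (ContinuousLinearMap.adjoint T).comp T

theorem inner_gram {H F : Type*} [NormedAddCommGroup H] [InnerProductSpace ℂ H]
    [CompleteSpace H] [NormedAddCommGroup F] [InnerProductSpace ℂ F] [CompleteSpace F]
    (T : H →L[ℂ] F) (x y : H) : inner ℂ x (gram T y) = inner ℂ (T x) (T y) :=
  ContinuousLinearMap.adjoint_inner_right T x (T y)

/-- The operator that represents the Helmholtz form. -/
noncomputable def helmholtzOp (D Γ₂ Γ₄ : Set E3) (ξ : ℂ) (k : ℝ) (h : H1Hilbert D) :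
    H1Hilbert D :=
  gram (gradientL D) h - (k : ℂ) ^ 2 • gram (valL D) h
    + (Complex.I * k / ξ) • gram (traceL D Γ₂) h + (Complex.I * k) • gram (traceL D Γ₄) h

/-- Joint continuity in k and the vector carries strong measurability from p over to its
representing vector. -/
theorem continuous_helmholtzOp (D Γ₂ Γ₄ : Set E3) (ξ : ℂ) :
    Continuous fun q : ℝ × H1Hilbert D => helmholtzOp D Γ₂ Γ₄ ξ q.1 q.2 := by
  unfold helmholtzOp
  have hk : Continuous fun q : ℝ × H1Hilbert D => (q.1 : ℂ) :=
    Complex.continuous_ofReal.comp continuous_fst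
  refine ((Continuous.sub ?_ ?_).add ?_).add ?_
  · exact (gram (gradientL D)).continuous.comp continuous_snd
  · exact (hk.pow 2).smul ((gram (valL D)).continuous.comp continuous_snd)
  · exact ((continuous_const.mul hk).div_const ξ).smul
      ((gram (traceL D Γ₂)).continuous.comp continuous_snd)
  · exact (continuous_const.mul hk).smul ((gram (traceL D Γ₄)).continuous.comp continuous_snd)

theorem inner_traceL (Γ : Set E3) (u φ : H1Data D) :
    inner ℂ (traceL D Γ (toHilbert D φ)) (traceL D Γ (toHilbert D u)) =
      ∫ x in Γ, u.trace x * conj (φ.trace x) ∂(surf D) := by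
  rw [L2.inner_def]
  refine integral_congr_ae ?_
  filter_upwards [LpToLpRestrictCLM_coeFn ℂ Γ u.trace, LpToLpRestrictCLM_coeFn ℂ Γ φ.trace]
    with x h1 h2
  change inner ℂ (LpToLpRestrictCLM E3 ℂ ℂ (surf D) 2 Γ φ.trace x)
    (LpToLpRestrictCLM E3 ℂ ℂ (surf D) 2 Γ u.trace x) = _
  rw [h1, h2]
  rfl

theorem helmholtzForm_eq_inner (Γ₂ Γ₄ : Set E3) (k : ℝ) (ξ : ℂ) (u φ : H1Data D) :
    helmholtzForm Γ₂ Γ₄ k ξ u φ =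
      inner ℂ (toHilbert D φ) (helmholtzOp D Γ₂ Γ₄ ξ k (toHilbert D u)) := by
  simp only [helmholtzOp, inner_add_right, inner_sub_right, inner_smul_right, inner_gram,
    inner_traceL]
  rfl

/-! ### From the averaged equation to almost every parameter. -/

theorem isFiniteMeasure_law {Λ : Set Param} {ρ : Param → ℝ≥0∞} (hρ : IsParamDensity Λ ρ) :
    IsFiniteMeasure (law Λ ρ) :=
  isFiniteMeasure_withDensity (by rw [hρ.lintegral_eq_one]; exact ENNReal.one_ne_top)

theorem h1NormSq_le (u : H1Data D) : h1NormSq u ≤ 2 * ‖u‖ₑ ^ 2 := by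
  have h1 : ‖u.val‖ₑ ≤ ‖u‖ₑ := enorm_le_iff_norm_le.2 (norm_fst_le u)
  have h2 : ‖u.gradient‖ₑ ≤ ‖u‖ₑ :=
    enorm_le_iff_norm_le.2 ((norm_fst_le u.2).trans (norm_snd_le u))
  rw [h1NormSq, ← Lp.enorm_def, ← Lp.enorm_def, two_mul]
  gcongr

/-- A strongly measurable map whose pairings with all bounded sections of a closed subspace have
vanishing integral is almost everywhere orthogonal to that subspace. -/
theorem ae_inner_eq_zero_of_integral_inner_eq_zero {H Ω : Type*} [NormedAddCommGroup H]
    [InnerProductSpace ℂ H] [CompleteSpace H] [MeasurableSpace Ω] {m : Measure Ω}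
    [IsFiniteMeasure m] (K : Submodule ℂ H) [CompleteSpace K] {A : Ω → H}
    (hA : AEStronglyMeasurable A m)
    (h : ∀ φ : Ω → H, AEStronglyMeasurable φ m → (∀ θ, φ θ ∈ K) → (∀ θ, ‖φ θ‖ ≤ 1) →
      ∫ θ, inner ℂ (φ θ) (A θ) ∂m = 0) :
    ∀ᵐ θ ∂m, ∀ ψ ∈ K, inner ℂ ψ (A θ) = 0 := by
  -- The test section is c R: its norm t/(1 + t²), with t = ‖R‖, is at most 1, and its pairing with
  -- A is t²/(1 + t²), which lies in [0, 1].
  let R : Ω → H := fun θ => K.starProjection (A θ)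
  let c : Ω → ℝ := fun θ => (1 + ‖R θ‖ ^ 2)⁻¹
  have hR : AEStronglyMeasurable R m := K.starProjection.continuous.comp_aestronglyMeasurable hA
  have hpos : ∀ θ, 0 < 1 + ‖R θ‖ ^ 2 := fun θ => by positivity
  have hcont : Continuous fun x : H => (1 + ‖x‖ ^ 2)⁻¹ :=
    (continuous_const.add (continuous_norm.pow 2)).inv₀ fun x =>
      (add_pos_of_pos_of_nonneg one_pos (sq_nonneg _)).ne'
  have hcR : AEStronglyMeasurable (fun θ => (c θ : ℂ) • R θ) m := by
    have : Continuous fun x : H => (((1 + ‖x‖ ^ 2)⁻¹ : ℝ) : ℂ) • x :=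
      (Complex.continuous_ofReal.comp hcont).smul continuous_id
    exact this.comp_aestronglyMeasurable hR
  have hcR1 : ∀ θ, ‖(c θ : ℂ) • R θ‖ ≤ 1 := fun θ => by
    rw [norm_smul, Complex.norm_real, Real.norm_of_nonneg (inv_nonneg.2 (hpos θ).le),
      inv_mul_le_iff₀ (hpos θ)]
    nlinarith [sq_nonneg (‖R θ‖ - 1), sq_nonneg ‖R θ‖]
  have hval : ∀ θ, inner ℂ ((c θ : ℂ) • R θ) (A θ) = ((c θ * ‖R θ‖ ^ 2 : ℝ) : ℂ) := by
    intro θ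
    have h := K.starProjection_inner_eq_zero (A θ) (R θ) (K.starProjection_apply_mem (A θ))
    rw [inner_eq_zero_symm, inner_sub_right, sub_eq_zero] at h
    rw [inner_smul_left, Complex.conj_ofReal, h, inner_self_eq_norm_sq_to_K]
    simp [R]
  have hint : ∫ θ, c θ * ‖R θ‖ ^ 2 ∂m = 0 := by
    have := h _ hcR (fun θ => K.smul_mem _ (K.starProjection_apply_mem (A θ))) hcR1
    simp only [hval] at this
    exact Complex.ofReal_eq_zero.1 (integral_ofReal.symm.trans this)
  have hnn : ∀ θ, 0 ≤ c θ * ‖R θ‖ ^ 2 := fun θ =>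
    mul_nonneg (inv_nonneg.2 (hpos θ).le) (sq_nonneg _)
  have hI : Integrable (fun θ => c θ * ‖R θ‖ ^ 2) m := by
    refine Integrable.of_bound (C := 1) ?_ (.of_forall fun θ => ?_)
    · have : Continuous fun x : H => (1 + ‖x‖ ^ 2)⁻¹ * ‖x‖ ^ 2 :=
        hcont.mul (continuous_norm.pow 2)
      exact this.comp_aestronglyMeasurable hR
    · rw [Real.norm_of_nonneg (hnn θ), inv_mul_le_iff₀ (hpos θ)]
      linarith
  filter_upwards [(integral_eq_zero_iff_of_nonneg hnn hI).1 hint] with θ hθ ψ hψ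
  have hR0 : ‖R θ‖ ^ 2 = 0 := (mul_eq_zero.1 hθ).resolve_left (inv_ne_zero (hpos θ).ne')
  have hR1 : K.starProjection (A θ) = 0 := norm_eq_zero.1 (pow_eq_zero_iff two_ne_zero |>.1 hR0)
  rw [inner_eq_zero_symm]
  simpa [hR1] using K.starProjection_inner_eq_zero (A θ) ψ hψ

/-- The preceding statement for forms represented by means of an isomorphism onto a Hilbert
space. -/
theorem ae_forall_eq_zero_of_integral_eq_zero {X H Ω : Type*} [NormedAddCommGroup X]
    [NormedSpace ℂ X] [NormedAddCommGroup H] [InnerProductSpace ℂ H] [CompleteSpace H]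
    [MeasurableSpace Ω] {m : Measure Ω} [IsFiniteMeasure m] (J : X ≃L[ℂ] H) {K : Submodule ℂ X}
    (hK : IsClosed (K : Set X)) {A : Ω → H} (hA : AEStronglyMeasurable A m) {a : Ω → X → ℂ}
    (ha : ∀ θ x, a θ x = inner ℂ (J x) (A θ))
    (h : ∀ (φ : Ω → X) (M : ℝ), AEStronglyMeasurable φ m → (∀ θ, φ θ ∈ K) →
      (∀ θ, ‖φ θ‖ ≤ M) → ∫ θ, a θ (φ θ) ∂m = 0) :
    ∀ᵐ θ ∂m, ∀ x ∈ K, a θ x = 0 := by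
  -- Test sections are moved back along `J.symm`, whose operator norm serves as the bound M.
  let K' : Submodule ℂ H := K.comap (J.symm : H →ₗ[ℂ] X)
  have hK' : IsClosed (K' : Set H) := hK.preimage J.symm.continuous
  have : CompleteSpace K' := hK'.completeSpace_coe
  have key := ae_inner_eq_zero_of_integral_inner_eq_zero K' hA fun φ hφ hφK hφ1 => by
    have := h (fun θ => J.symm (φ θ)) _ (J.symm.continuous.comp_aestronglyMeasurable hφ) hφK
      fun θ => ((J.symm : H →L[ℂ] X).le_opNorm (φ θ)).trans
        (mul_le_of_le_one_right (norm_nonneg _) (hφ1 θ))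
    simpa only [ha, ContinuousLinearEquiv.apply_symm_apply] using this
  filter_upwards [key] with θ hθ x hx
  rw [ha]
  refine hθ _ ?_
  change J.symm (J x) ∈ K
  rwa [J.symm_apply_apply]

theorem lintegral_h1NormSq_lt_top {Ω : Type*} [MeasurableSpace Ω] {m : Measure Ω}
    [IsFiniteMeasure m] {φ : Ω → H1Data D} {M : ℝ} (hφ : ∀ θ, ‖φ θ‖ ≤ M) :
    ∫⁻ θ, h1NormSq (φ θ) ∂m < ⊤ := by
  have hb : ∀ θ, h1NormSq (φ θ) ≤ 2 * ENNReal.ofReal M ^ 2 := fun θ => by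
    refine (h1NormSq_le _).trans ?_
    gcongr
    rw [← ofReal_norm]
    exact ENNReal.ofReal_le_ofReal (hφ θ)
  refine (lintegral_mono hb).trans_lt ?_
  rw [lintegral_const]
  exact ENNReal.mul_lt_top (ENNReal.mul_lt_top (by simp) (by simp)) (measure_lt_top _ _)

/-- The stochastic equation holds for almost every parameter separately. -/
theorem ae_helmholtzForm_eq_zero {Γ₁ Γ₂ Γ₄ : Set E3} {g : E3 → ℂ} {Λ : Set Param}
    {ρ : Param → ℝ≥0∞} (hρ : IsParamDensity Λ ρ) {ξ : ℂ} {p : Param → H1Data D}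
    (hp : IsStochasticSolution D Γ₁ Γ₂ Γ₄ g Λ ρ ξ p) :
    ∀ᵐ θ ∂(law Λ ρ), ∀ φ ∈ V₀ D Γ₁, helmholtzForm Γ₂ Γ₄ θ.k ξ (p θ) φ = 0 := by
  obtain ⟨hpY, heq⟩ := hp
  have := isFiniteMeasure_law hρ
  obtain ⟨K, hK, hmem⟩ := exists_closed_submodule_V₀ D Γ₁
  have hk : Measurable Param.k := measurable_fst
  have hJp : AEStronglyMeasurable (fun θ => toHilbert D (p θ)) (law Λ ρ) :=
    (toHilbert D).continuous.comp_aestronglyMeasurable hpY.aestronglyMeasurable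
  have hkp : AEStronglyMeasurable (fun θ => (θ.k, toHilbert D (p θ))) (law Λ ρ) :=
    hk.aestronglyMeasurable.prodMk hJp
  have hA := (continuous_helmholtzOp D Γ₂ Γ₄ ξ).comp_aestronglyMeasurable hkp
  have key := ae_forall_eq_zero_of_integral_eq_zero (toHilbert D) hK hA
    (fun θ φ => helmholtzForm_eq_inner Γ₂ Γ₄ θ.k ξ (p θ) φ) fun φ M hφ hφK hφM =>
      heq φ ⟨hφ, .of_forall fun θ => (hmem _).1 (hφK θ), lintegral_h1NormSq_lt_top hφM⟩
  filter_upwards [key] with θ hθ φ hφ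
  exact hθ φ ((hmem φ).2 hφ)

/-! ### The difference of two solutions and the stability estimate. -/

theorem helmholtzForm_sub (Γ₂ Γ₄ : Set E3) (k : ℝ) (ξ : ℂ) (u v φ : H1Data D) :
    helmholtzForm Γ₂ Γ₄ k ξ (u - v) φ =
      helmholtzForm Γ₂ Γ₄ k ξ u φ - helmholtzForm Γ₂ Γ₄ k ξ v φ := by
  simp only [helmholtzForm_eq_inner, helmholtzOp, map_sub, smul_sub, inner_add_right,
    inner_sub_right]
  ring

theorem helmholtzForm_sub_impedance (Γ₂ Γ₄ : Set E3) (k : ℝ) (ξ₁ ξ₂ : ℂ) (u φ : H1Data D) :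
    helmholtzForm Γ₂ Γ₄ k ξ₁ u φ - helmholtzForm Γ₂ Γ₄ k ξ₂ u φ =
      Complex.I * k * (1 / ξ₁ - 1 / ξ₂) *
        ∫ x in Γ₂, u.trace x * conj (φ.trace x) ∂(surf D) := by
  unfold helmholtzForm
  ring

/-- Two solutions for different impedances differ by a solution of the mixed problem whose datum
is a multiple of the trace on `Γ₂` of the second one. -/
theorem isMixedWeakSolution_sub {Γ₁ Γ₂ Γ₄ : Set E3} (hΓ₂ : MeasurableSet Γ₂) {k : ℝ} {ξ₁ ξ₂ : ℂ}
    {h : E3 → ℂ} {u v : H1Data D} (hu : u ∈ V D Γ₁ h) (hv : v ∈ V D Γ₁ h)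
    (hu0 : ∀ φ ∈ V₀ D Γ₁, helmholtzForm Γ₂ Γ₄ k ξ₁ u φ = 0)
    (hv0 : ∀ φ ∈ V₀ D Γ₁, helmholtzForm Γ₂ Γ₄ k ξ₂ v φ = 0) :
    IsMixedWeakSolution Γ₁ Γ₂ Γ₄ k ξ₁ 0
      (Γ₂.indicator fun x => -(Complex.I * k * (1 / ξ₁ - 1 / ξ₂)) * v.trace x) (u - v) := by
  refine ⟨sub_mem_V₀ hu hv, fun φ hφ => ?_⟩
  have e : ∀ x, Γ₂.indicator (fun x => -(Complex.I * k * (1 / ξ₁ - 1 / ξ₂)) * v.trace x) x *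
      conj (φ.trace x) = Γ₂.indicator (fun x => -(Complex.I * k * (1 / ξ₁ - 1 / ξ₂)) *
        (v.trace x * conj (φ.trace x))) x := fun x => by
    by_cases hx : x ∈ Γ₂ <;> simp [hx, mul_assoc]
  -- As v solves the ξ₂ equation, its ξ₁ form reduces to the Γ₂ term; subtracting it accounts for
  -- the minus sign in the datum.
  have hsub := helmholtzForm_sub_impedance Γ₂ Γ₄ k ξ₁ ξ₂ v φ
  rw [hv0 φ hφ, sub_zero] at hsub
  rw [helmholtzForm_sub, hu0 φ hφ, hsub]
  simp only [e, Pi.zero_apply, zero_mul, integral_zero, zero_add]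
  rw [integral_indicator hΓ₂, Measure.restrict_restrict_of_subset Set.subset_union_left,
    integral_const_mul]
  ring

theorem l2norm_const_mul (m : Measure E3) (c : ℂ) (f : E3 → ℂ) :
    l2norm m (fun x => c * f x) = ‖c‖ * l2norm m f := by
  have := eLpNorm_const_smul c f 2 m
  rw [l2norm, l2norm, show (fun x => c * f x) = c • f from rfl, this, ENNReal.toReal_mul,
    toReal_enorm]

theorem l2norm_indicator {m : Measure E3} {s t : Set E3} (hs : MeasurableSet s) (hst : s ⊆ t)
    (f : E3 → ℂ) : l2norm (m.restrict t) (s.indicator f) = l2norm (m.restrict s) f := by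
  rw [l2norm, l2norm, eLpNorm_indicator_eq_eLpNorm_restrict hs, Measure.restrict_restrict hs,
    Set.inter_eq_left.2 hst]

/-- The factor k is the modulus of ik in the boundary datum. -/
theorem hNorm_sub_le {Γ₁ Γ₂ Γ₄ : Set E3} (hΓ₂ : MeasurableSet Γ₂) {C₁ : ℝ → ℂ → ℝ}
    (hstab : StabilityEstimate D Γ₁ Γ₂ Γ₄ C₁) {k : ℝ} (hk : 0 < k) {ξ₁ ξ₂ : ℂ} (hξ₁ : 0 < ξ₁.re)
    {h : E3 → ℂ} {u v : H1Data D} (hu : u ∈ V D Γ₁ h) (hv : v ∈ V D Γ₁ h)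
    (hu0 : ∀ φ ∈ V₀ D Γ₁, helmholtzForm Γ₂ Γ₄ k ξ₁ u φ = 0)
    (hv0 : ∀ φ ∈ V₀ D Γ₁, helmholtzForm Γ₂ Γ₄ k ξ₂ v φ = 0) :
    hNorm k (u - v) ≤
      C₁ k ξ₁ * (k * l2norm ((surf D).restrict Γ₂) v.trace) * ‖1 / ξ₁ - 1 / ξ₂‖ := by
  have hg : MemLp (Γ₂.indicator fun x => -(Complex.I * k * (1 / ξ₁ - 1 / ξ₂)) * v.trace x) 2
      ((surf D).restrict (Γ₂ ∪ Γ₄)) :=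
    (((Lp.memLp v.trace).restrict _).const_mul _).indicator hΓ₂
  have := hstab k ξ₁ hk hξ₁ 0 _ MemLp.zero hg _ (isMixedWeakSolution_sub hΓ₂ hu hv hu0 hv0)
  rw [l2norm_indicator hΓ₂ Set.subset_union_left, l2norm_const_mul] at this
  refine this.trans_eq ?_
  simp only [l2norm, eLpNorm_zero, ENNReal.toReal_zero, zero_add, norm_neg, norm_mul,
    Complex.norm_I, Complex.norm_real, Real.norm_of_nonneg hk.le]
  ring

theorem ae_mem_of_law {Λ : Set Param} {ρ : Param → ℝ≥0∞} (hΛ : MeasurableSet Λ) :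
    ∀ᵐ θ ∂(law Λ ρ), θ ∈ Λ :=
  (withDensity_absolutelyContinuous _ ρ).ae_le (ae_restrict_mem hΛ)

end Helmholtz

theorem mainTheorem6
    (D Γ₁ Γ₂ Γ₃ Γ₄ Γ₅ : Set Helmholtz.E3)
    (hD : Helmholtz.IsLipschitzDomain D)
    (hΓ : Helmholtz.IsBoundaryPartition D Γ₁ Γ₂ Γ₃ Γ₄ Γ₅)
    (C₁ : ℝ → ℂ → ℝ) (hC₁ : Helmholtz.IsCoefficient C₁)
    (hstab : Helmholtz.StabilityEstimate D Γ₁ Γ₂ Γ₄ C₁) :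
    ∃ C : ℝ → ℂ → ℝ, Helmholtz.IsCoefficient C ∧
      ∀ (g : Helmholtz.E3 → ℂ) (pg : Helmholtz.H1Data D), Helmholtz.IsHarmonicLift Γ₁ g pg →
      ∀ (Λ : Set Helmholtz.Param) (ρ : Helmholtz.Param → ENNReal),
        Helmholtz.IsParamDensity Λ ρ →
      ∀ ξ₁ ξ₂ : ℂ, 0 < ξ₁.re → 0 < ξ₂.re →
      ∀ p₁ p₂ : Helmholtz.Param → Helmholtz.H1Data D,
        Helmholtz.IsStochasticSolution D Γ₁ Γ₂ Γ₄ g Λ ρ ξ₁ p₁ →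
        Helmholtz.IsStochasticSolution D Γ₁ Γ₂ Γ₄ g Λ ρ ξ₂ p₂ →
        ∀ᵐ θ ∂(Helmholtz.law Λ ρ),
          Helmholtz.hNorm θ.k (p₁ θ - p₂ θ) ≤
            C θ.k ξ₁ *
              (Helmholtz.l2norm ((Helmholtz.surf D).restrict Γ₂) (p₂ θ).trace
                + ‖θ.μ‖ * θ.k * Helmholtz.l2norm ((Helmholtz.surf D).restrict Γ₂) pg.trace) *
              ‖1 / ξ₁ - 1 / ξ₂‖ ∧
          Helmholtz.hNorm θ.k (p₁ θ - p₂ θ) ≤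
            C₁ θ.k ξ₁ *
              (θ.k * Helmholtz.l2norm ((Helmholtz.surf D).restrict Γ₂) (p₂ θ).trace
                + ‖θ.μ‖ * θ.k * Helmholtz.l2norm ((Helmholtz.surf D).restrict Γ₂) pg.trace) *
              ‖1 / ξ₁ - 1 / ξ₂‖ := by
  -- The first bound carries ‖p₂‖ without its weight k, so k is absorbed into C.
  refine ⟨fun k ξ => k * C₁ k ξ, ⟨continuous_fst.continuousOn.mul hC₁.continuousOn,
    fun k ξ hk hξ => mul_pos hk (hC₁.pos k ξ hk hξ)⟩, ?_⟩
  intro g pg _ Λ ρ hρ ξ₁ ξ₂ hξ₁ _ p₁ p₂ hp₁ hp₂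
  filter_upwards [Helmholtz.ae_mem_of_law hρ.measurableSet, hp₁.1.mem, hp₂.1.mem,
    Helmholtz.ae_helmholtzForm_eq_zero hρ hp₁, Helmholtz.ae_helmholtzForm_eq_zero hρ hp₂]
    with θ hθ m₁ m₂ e₁ e₂
  have hk := hρ.k_pos θ hθ
  have hC := hC₁.pos θ.k ξ₁ hk hξ₁
  have hpg : 0 ≤ ‖θ.μ‖ * θ.k *
      Helmholtz.l2norm ((Helmholtz.surf D).restrict Γ₂) pg.trace :=
    mul_nonneg (mul_nonneg (norm_nonneg _) hk.le) ENNReal.toReal_nonneg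
  have hΓ₂ : MeasurableSet Γ₂ := hΓ.measurable 1
  have main := Helmholtz.hNorm_sub_le hΓ₂ hstab hk hξ₁ (ξ₂ := ξ₂) m₁ m₂ e₁ e₂
  constructor
  · refine main.trans (mul_le_mul_of_nonneg_right ?_ (norm_nonneg _))
    -- The two sides differ by exactly k C₁ times the p_g term.
    nlinarith [mul_nonneg (mul_nonneg hk.le hC.le) hpg]
  · refine main.trans (mul_le_mul_of_nonneg_right ?_ (norm_nonneg _))
    exact mul_le_mul_of_nonneg_left (le_add_of_nonneg_right hpg) hC.le
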